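/- Let $n\ge 1$ be an integer, $q=2^n$, and let $c\in\mathbb{F}_{q^4}$ satisfy $c^{q^2+1}=1$ and $c\neq 1$. Write $\mathrm{Tr}_n^{4n}(y)=y+y^{q}+y^{q^2}+y^{q^3}$ for the relative trace from $\mathbb{F}_{q^4}$ to $\mathbb{F}_q$. Let $b\in\mathbb{F}_{q^4}$ and put $v=b^q+b^{q^2}$. Then the equation $$(x+1)^{(q-1)(q^2+1)+2}+c^2x^{(q-1)(q^2+1)+2}=b^2$$ has exactly one solution $x\in\mathbb{F}_{q^4}$ if and only if $\mathrm{Tr}_n^{4n}(c^{q+1}v^{2q})=0$ and $\mathrm{Tr}_n^{4n}(c(v+v^q))=0$. -/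

import Mathlib

/-- The relative trace `Tr_m^N : 𝔽_{2^N} → 𝔽_{2^m}` (for `m ∣ N`, in characteristic two), as an
element of the larger field:
`Tr_m^N(x) = x + x^(2^m) + x^(2^(2m)) + ⋯ + x^(2^((N/m - 1)m))`. -/
def relTrace {F : Type*} [Field F] (m N : ℕ) (x : F) : F :=
  ∑ i ∈ Finset.range (N / m), x ^ (2 ^ (i * m))

/-! Let `σ` be the `q`-power Frobenius, of order 4. The power in the equation is `x ^ 2 * (σ n / n)`
with `n = x * σ (σ x)`. Write `σ n / n = e ^ 2` (`e` is the phase of `x`); then `e * σ e = 1`. With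
phases `e0` of `x` and `e1` of `x + 1`, a square root of the equation gives `x * (e1 + c * e0) = b +
e1`, so a solution other than 0, 1 is determined by its phases.

Which pairs occur? Both phases satisfy equations `σ W * e + W * σ e + M = 0` with a common `W`, and
they interact only through `r = e0 * σ e1 + e1 * σ e0` (`phasePair_iff_quadratics`). As `σ e = e⁻¹`,
these are quadratics, and exchanging both pairs of roots preserves `r`. So solutions come in twos
(`PhasePair.exists_conj`, or `PhasePair.exists_scaled` if `W = 0`), unless both middle terms vanish
at `r = 0`.

The trace conditions express that vanishing, and they amount to `b = s + w * c` with `s`, `w` fixed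
by `σ` (`trace_conditions`). For such `b` other than 1, `c`, a resultant forces `r = 0`, hence `e0 =
e1` with `e0 ^ 2 = W / σ W`: exactly one solution (`existsUnique_isSolution_of_span`). The cases `b
= 1`, `b = c` have the solutions 0 and 1. -/

section CharTwo
set_option linter.unusedSectionVars false
variable {F : Type*} [Field F] [CharP F 2]

/-! ### Phases and the equation relating them -/

/-- `ε ^ 2` is the quotient `σ n / n` for `n = u * σ² u`. -/
def IsPhase (σ : F →+* F) (u ε : F) : Prop :=
  ε ^ 2 * (u * σ (σ u)) = σ u * σ (σ (σ u))

/-- The equation on `ε = ε(x + 1)` equivalent to `IsPhase σ x ε₀`, where `r` is the cross term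
`ε₀ * σ ε + ε * σ ε₀`. -/
def PhaseEq (σ : F →+* F) (c b r ε : F) : Prop :=
  σ ε * ((b + ε) * (σ (σ b) + ε)) * (r + σ (c + σ (σ c))) =
    ε * ((σ b + σ ε) * (σ (σ (σ b)) + σ ε)) * (r + (c + σ (σ c)))

lemma eq_of_sq_eq_sq_charTwo {x y : F} (h : x ^ 2 = y ^ 2) : x = y := by
  have := CharTwo.two_eq_zero (R := F)
  have h : (x - y) ^ 2 = 0 := by linear_combination h + (y ^ 2 - x * y) * this
  exact sub_eq_zero.1 (pow_eq_zero_iff two_ne_zero |>.1 h)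

variable {σ : F →+* F} (h4 : ∀ x, σ (σ (σ (σ x))) = x)

include h4 in
lemma IsPhase.mul_map {u ε : F} (hu : u ≠ 0) (h : IsPhase σ u ε) : ε * σ ε = 1 := by
  unfold IsPhase at h
  have h' := congrArg σ h
  simp only [map_mul, map_pow, h4] at h'
  apply eq_of_sq_eq_sq_charTwo
  have n0 : u * σ (σ u) ≠ 0 := by simp [hu]
  apply mul_right_cancel₀ n0
  linear_combination σ ε ^ 2 * h + h'

lemma map_map_of_mul_map {ε : F} (h : ε * σ ε = 1) : σ (σ ε) = ε := by
  have h' := congrArg σ h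
  simp only [map_mul, map_one] at h'
  linear_combination - σ (σ ε) * h + ε * h'

/-- The norm of the denominator of `x` to the fixed field of `σ ∘ σ`; it sees `e0`, `e1` only
through their product and the cross term. -/
lemma phase_factor {c e0 e1 : F} (hc : c * σ (σ c) = 1) (h0 : e0 * σ e0 = 1)
    (h1 : e1 * σ e1 = 1) :
    (e1 + c * e0) * (e1 + σ (σ c) * e0) =
      e0 * e1 * (e0 * σ e1 + e1 * σ e0 + (c + σ (σ c))) := by
  linear_combination e0 ^ 2 * hc - e0 ^ 2 * h1 - e1 ^ 2 * h0

include h4 in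
-- After substituting `x = (b + e1) / (e1 + c * e0)`, the factors `e0` from `phase_factor` cancel
-- the square in `IsPhase`, so `e0` survives only inside the cross term.
lemma IsPhase.phaseEq_iff {c b x e0 e1 : F} (hc : c * σ (σ c) = 1) (h0 : e0 * σ e0 = 1)
    (h1 : e1 * σ e1 = 1) (hD : e1 + c * e0 ≠ 0) (hx : x * (e1 + c * e0) = b + e1) :
    IsPhase σ x e0 ↔ PhaseEq σ c b (e0 * σ e1 + e1 * σ e0) e1 := by
  have k := phase_factor hc h0 h1
  have k' := congrArg σ k
  have s0 := map_map_of_mul_map h0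
  have s1 := map_map_of_mul_map h1
  have hx1 := congrArg σ hx
  have hx2 := congrArg σ hx1
  have hx3 := congrArg σ hx2
  have hD1 : σ (e1 + c * e0) ≠ 0 := by simpa only [ne_eq, map_eq_zero] using hD
  have hD2 : σ (σ (e1 + c * e0)) ≠ 0 := by simpa only [ne_eq, map_eq_zero] using hD
  have hD3 : σ (σ (σ (e1 + c * e0))) ≠ 0 := by simpa only [ne_eq, map_eq_zero] using hD
  have e00 : e0 ≠ 0 := left_ne_zero_of_mul_eq_one h0
  simp only [map_mul, map_add, s0, s1] at k' hx1 hx2 hx3 hD1 hD2 hD3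
  unfold IsPhase PhaseEq
  simp only [map_add]
  set D := (e1 + c * e0) * (e1 + σ (σ c) * e0) with hDD
  set D' := (σ e1 + σ c * σ e0) * (σ e1 + σ (σ (σ c)) * σ e0) with hDD'
  have Q : x * σ (σ x) * D = (b + e1) * (σ (σ b) + e1) := by
    rw [← hx, ← hx2]; ring
  have Q' : σ x * σ (σ (σ x)) * D' = (σ b + σ e1) * (σ (σ (σ b)) + σ e1) := by
    rw [← hx1, ← hx3]; ring
  rw [← Q, ← Q']
  have n0 : D * D' ≠ 0 := by
    simp only [D, D']; exact mul_ne_zero (mul_ne_zero hD hD2) (mul_ne_zero hD1 hD3)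
  have kk : σ e1 * (σ c + σ (σ (σ c)) + (e0 * σ e1 + e1 * σ e0)) * σ e0 = D' := by
    rw [k']; ring
  rw [← mul_left_inj' n0]
  have a1 : σ e1 * (x * σ (σ x) * D) * (e0 * σ e1 + e1 * σ e0 + (σ c + σ (σ (σ c))))
      = e0 * (x * σ (σ x)) * D * D' := by
    linear_combination e0 * (x * σ (σ x)) * D * kk -
      (σ e1 * (x * σ (σ x) * D) * (e0 * σ e1 + e1 * σ e0 + (σ c + σ (σ (σ c))))) * h0
  have a2 : e1 * (σ x * σ (σ (σ x)) * D') * (e0 * σ e1 + e1 * σ e0 + (c + σ (σ c))) * e0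
      = σ x * σ (σ (σ x)) * D * D' := by
    linear_combination - (σ x * σ (σ (σ x)) * D') * k
  rw [a1]
  constructor <;> intro h
  · apply mul_right_cancel₀ e00; linear_combination h - a2
  · linear_combination e0 * h + a2

/-! ### The phase equation as a quadratic -/

/-- The outer coefficient of the quadratic equation equivalent to `PhaseEq` -/
def phaseOuter (σ : F →+* F) (c b r : F) : F :=
  (r + σ (c + σ (σ c))) * (b * σ (σ b)) + (r + (c + σ (σ c)))

/-- The middle coefficient of the quadratic equation equivalent to `PhaseEq` -/
def phaseMiddle (σ : F →+* F) (c b r : F) : F :=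
  (r + σ (c + σ (σ c))) * (b + σ (σ b)) + (r + (c + σ (σ c))) * σ (b + σ (σ b))

include h4 in
lemma phaseEq_iff_quadratic {c b r e : F} (h : e * σ e = 1) (hr : σ r = r) :
    PhaseEq σ c b r e ↔
      σ (phaseOuter σ c b r) * e + phaseOuter σ c b r * σ e + phaseMiddle σ c b r = 0 := by
  have := CharTwo.two_eq_zero (R := F)
  have h2 := map_map_of_mul_map h
  unfold PhaseEq phaseOuter phaseMiddle
  simp only [map_add, map_mul, h4, hr]
  generalize r + (σ c + σ (σ (σ c))) = κ
  have : r + (σ (σ c) + c) = r + (c + σ (σ c)) := by ring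
  rw [this]
  generalize r + (c + σ (σ c)) = κ'
  constructor <;> intro H
  · grind
  · grind

include h4 in
lemma map_map_phaseOuter {c b r : F} (hr : σ r = r) :
    σ (σ (phaseOuter σ c b r)) = phaseOuter σ c b r := by
  unfold phaseOuter
  simp only [map_add, map_mul, h4, hr]
  ring

include h4 in
-- Dividing the equation by `c ^ 2` and exchanging `x` with `x + 1` replaces `(c, b)` by `(c⁻¹, b *
-- c⁻¹)`. Since `c` has norm 1, the outer coefficient is unchanged, so `e0` and `e1` share it.
lemma phaseOuter_swap {c b r : F} (hc : c * σ (σ c) = 1) :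
    phaseOuter σ (σ (σ c)) (b * σ (σ c)) r = phaseOuter σ c b r := by
  unfold phaseOuter
  simp only [map_add, map_mul, h4]
  linear_combination (r + (σ c + σ (σ (σ c)))) * (b * σ (σ b)) * hc

lemma map_phaseCross {e0 e1 : F} (h0 : e0 * σ e0 = 1) (h1 : e1 * σ e1 = 1) :
    σ (e0 * σ e1 + e1 * σ e0) = e0 * σ e1 + e1 * σ e0 := by
  simp only [map_add, map_mul, map_map_of_mul_map h0, map_map_of_mul_map h1]
  ring

/-! ### Solutions and phase pairs -/

/-- The equation `(x + 1) ^ e + c ^ 2 * x ^ e = b ^ 2`, with `x ^ e` written as `x ^ 2 * (σ n / n)`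
for `n = x * σ² x`. -/
def IsSolution (σ : F →+* F) (c b x : F) : Prop :=
  (x + 1) ^ 2 * (σ ((x + 1) * σ (σ (x + 1))) / ((x + 1) * σ (σ (x + 1)))) +
    c ^ 2 * (x ^ 2 * (σ (x * σ (σ x)) / (x * σ (σ x)))) = b ^ 2

/-- The pairs `(e0, e1)` that arise as the phases of `x` and `x + 1` for a solution `x ≠ 0, 1`. -/
structure PhasePair (σ : F →+* F) (c b e0 e1 : F) : Prop where
  unit0 : e0 * σ e0 = 1
  unit1 : e1 * σ e1 = 1
  eq1 : PhaseEq σ c b (e0 * σ e1 + e1 * σ e0) e1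
  eq0 : PhaseEq σ (σ (σ c)) (b * σ (σ c)) (e0 * σ e1 + e1 * σ e0) e0

lemma exists_isPhase [Finite F] {u : F} (hu : u ≠ 0) : ∃ e, IsPhase σ u e := by
  cases nonempty_fintype F
  obtain ⟨e, he⟩ := FiniteField.isSquare_of_char_two (ringChar.eq F 2 ▸ rfl)
    (σ u * σ (σ (σ u)) / (u * σ (σ u)))
  refine ⟨e, ?_⟩
  have : u * σ (σ u) ≠ 0 := by simp [hu]
  rw [IsPhase, pow_two, ← he, div_mul_cancel₀ _ this]

lemma IsPhase.div_eq {u e : F} (hu : u ≠ 0) (h : IsPhase σ u e) :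
    σ (u * σ (σ u)) / (u * σ (σ u)) = e ^ 2 := by
  have : u * σ (σ u) ≠ 0 := by simp [hu]
  rw [div_eq_iff this, map_mul]; exact h.symm

lemma isSolution_iff {c b x e0 e1 : F} (hx : x ≠ 0) (hx1 : x + 1 ≠ 0) (h0 : IsPhase σ x e0)
    (h1 : IsPhase σ (x + 1) e1) : IsSolution σ c b x ↔ x * (e1 + c * e0) = b + e1 := by
  have := CharTwo.two_eq_zero (R := F)
  rw [IsSolution, h0.div_eq hx, h1.div_eq hx1]
  constructor <;> intro h
  · have : (x + 1) * e1 + c * x * e0 = b := by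
      apply eq_of_sq_eq_sq_charTwo
      grind
    grind
  · grind

lemma mul_map_map_ne {c : F} (hc : c * σ (σ c) = 1) (hc1 : c ≠ 1) : σ (σ c) ≠ c := by
  intro h
  rw [h] at hc
  exact hc1 (eq_of_sq_eq_sq_charTwo (by rw [one_pow, ← hc, pow_two]))

lemma phase_denominator_ne_zero {c e0 e1 : F} (hc : c * σ (σ c) = 1) (hc1 : c ≠ 1)
    (h0 : e0 * σ e0 = 1) (h1 : e1 * σ e1 = 1) : e1 + c * e0 ≠ 0 := by
  intro h
  have h' := congrArg σ (congrArg σ h)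
  simp only [map_mul, map_add, map_map_of_mul_map h0, map_map_of_mul_map h1, map_zero] at h'
  apply mul_map_map_ne hc hc1
  apply mul_right_cancel₀ (left_ne_zero_of_mul_eq_one h0)
  linear_combination h' - h

include h4 in
lemma swap_unit {c : F} (hc : c * σ (σ c) = 1) : σ (σ c) * σ (σ (σ (σ c))) = 1 := by
  rw [h4, mul_comm, hc]

include h4 in
lemma phasePair_iff {c b x e0 e1 : F} (hc : c * σ (σ c) = 1) (hc1 : c ≠ 1) (h0 : e0 * σ e0 = 1)
    (h1 : e1 * σ e1 = 1) (hx : x * (e1 + c * e0) = b + e1) :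
    PhasePair σ c b e0 e1 ↔ IsPhase σ x e0 ∧ IsPhase σ (x + 1) e1 := by
  have two := CharTwo.two_eq_zero (R := F)
  have hD := phase_denominator_ne_zero hc hc1 h0 h1
  have hD' : e0 + σ (σ c) * e1 ≠ 0 := by
    intro h; apply hD; linear_combination c * h - e1 * hc
  have hx' : (x + 1) * (e0 + σ (σ c) * e1) = b * σ (σ c) + e0 := by
    linear_combination σ (σ c) * hx - (x * e0) * hc + e1 * σ (σ c) * two
  rw [IsPhase.phaseEq_iff h4 hc h0 h1 hD hx,
    IsPhase.phaseEq_iff h4 (swap_unit h4 hc) h1 h0 hD' hx']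
  rw [add_comm (e1 * σ e0)]
  exact ⟨fun h => ⟨h.eq1, h.eq0⟩, fun h => ⟨h0, h1, h.1, h.2⟩⟩

include h4 in
lemma exists_phasePair [Finite F] {c b x : F} (hc : c * σ (σ c) = 1) (hc1 : c ≠ 1)
    (hx : x ≠ 0) (hx1 : x + 1 ≠ 0) (h : IsSolution σ c b x) :
    ∃ e0 e1, PhasePair σ c b e0 e1 ∧ x * (e1 + c * e0) = b + e1 := by
  obtain ⟨e0, h0⟩ := exists_isPhase (σ := σ) hx
  obtain ⟨e1, h1⟩ := exists_isPhase (σ := σ) hx1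
  have h' := (isSolution_iff hx hx1 h0 h1).1 h
  exact ⟨e0, e1, (phasePair_iff h4 hc hc1 (h0.mul_map h4 hx) (h1.mul_map h4 hx1) h').2 ⟨h0, h1⟩, h'⟩

include h4 in
lemma PhasePair.exists_root {c b e0 e1 : F} (hc : c * σ (σ c) = 1) (hc1 : c ≠ 1)
    (h : PhasePair σ c b e0 e1) (hb1 : b ≠ e1) (hb0 : b * σ (σ c) ≠ e0) :
    ∃ x, x ≠ 0 ∧ x + 1 ≠ 0 ∧ IsSolution σ c b x ∧ IsPhase σ x e0 ∧ IsPhase σ (x + 1) e1 := by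
  have two := CharTwo.two_eq_zero (R := F)
  have hD := phase_denominator_ne_zero hc hc1 h.unit0 h.unit1
  have hx : (b + e1) / (e1 + c * e0) * (e1 + c * e0) = b + e1 := div_mul_cancel₀ _ hD
  generalize (b + e1) / (e1 + c * e0) = x at hx
  have x0 : x ≠ 0 := by
    rintro rfl
    exact hb1 (by linear_combination - hx - e1 * two)
  have x1 : x + 1 ≠ 0 := by
    intro h'
    apply hb0
    linear_combination σ (σ c) * (e1 + c * e0) * h' - σ (σ c) * hx - e0 * hc -
      (σ (σ c) * e1 + e0) * two
  obtain ⟨p0, p1⟩ := (phasePair_iff h4 hc hc1 h.unit0 h.unit1 hx).1 h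
  exact ⟨x, x0, x1, (isSolution_iff x0 x1 p0 p1).2 hx, p0, p1⟩

lemma IsPhase.unique {u e e' : F} (hu : u ≠ 0) (h : IsPhase σ u e) (h' : IsPhase σ u e') :
    e = e' := by
  apply eq_of_sq_eq_sq_charTwo
  rw [← h.div_eq hu, h'.div_eq hu]

include h4 in
lemma phasePair_iff_quadratics {c b r e0 e1 : F} (hc : c * σ (σ c) = 1) (h0 : e0 * σ e0 = 1)
    (h1 : e1 * σ e1 = 1) (hr : e0 * σ e1 + e1 * σ e0 = r) :
    PhasePair σ c b e0 e1 ↔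
      σ (phaseOuter σ c b r) * e1 + phaseOuter σ c b r * σ e1 + phaseMiddle σ c b r = 0 ∧
      σ (phaseOuter σ c b r) * e0 + phaseOuter σ c b r * σ e0 +
        phaseMiddle σ (σ (σ c)) (b * σ (σ c)) r = 0 := by
  have hs : σ r = r := by rw [← hr, map_phaseCross h0 h1]
  rw [← phaseEq_iff_quadratic h4 h1 hs, ← phaseOuter_swap h4 hc,
    ← phaseEq_iff_quadratic h4 h0 hs, ← hr]
  exact ⟨fun h => ⟨h.eq1, h.eq0⟩, fun h => ⟨h0, h1, h.1, h.2⟩⟩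

/-! ### The trace of `c`, and a second phase pair -/

include h4 in
lemma phaseMiddle_eq_zero_of_map_map {c b r : F} (hb : σ (σ b) = b) :
    phaseMiddle σ c b r = 0 := by
  have two := CharTwo.two_eq_zero (R := F)
  simp only [phaseMiddle, hb, ← two_mul, two, zero_mul, map_zero, mul_zero]

lemma map_ne_self {c : F} (hc : c * σ (σ c) = 1) (hc1 : c ≠ 1) : σ c ≠ c :=
  fun h => mul_map_map_ne hc hc1 (by rw [h, h])

include h4 in
lemma map_trace_ne {c : F} (hc : c * σ (σ c) = 1) (hc1 : c ≠ 1) :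
    σ (c + σ (σ c)) ≠ c + σ (σ c) := by
  have two := CharTwo.two_eq_zero (R := F)
  intro h
  have hc' : σ c * σ (σ (σ c)) = 1 := by simpa using congrArg σ hc
  rw [map_add] at h
  have : (σ c - c) * (σ (σ c) * σ (σ (σ c)) - 1) = 0 := by
    grind
  rcases mul_eq_zero.1 this with h' | h'
  · exact map_ne_self hc hc1 (sub_eq_zero.1 h')
  · apply map_ne_self hc hc1
    have : σ (σ (σ c)) = c := by
      linear_combination c * h' - σ (σ (σ c)) * hc
    have := congrArg σ this
    rw [h4] at this
    exact this.symm

include h4 in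
lemma trace_ne_zero {c : F} (hc : c * σ (σ c) = 1) (hc1 : c ≠ 1) : c + σ (σ c) ≠ 0 := by
  intro h
  apply map_trace_ne h4 hc hc1
  rw [h, map_zero]

include h4 in
lemma exists_unit_ne {c : F} (hc : c * σ (σ c) = 1) (hc1 : c ≠ 1) :
    ∃ u : F, u * σ u = 1 ∧ u ≠ 1 ∧ σ u ≠ 1 ∧ u ≠ σ u := by
  have t0 := trace_ne_zero h4 hc hc1
  have t1 := map_trace_ne h4 hc hc1
  have h2 : σ (σ (c + σ (σ c))) = c + σ (σ c) := by simp only [map_add, h4]; ring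
  generalize c + σ (σ c) = τ at t0 t1 h2
  have t2 : σ τ ≠ 0 := by simpa using t0
  have hu : τ / σ τ * σ (τ / σ τ) = 1 := by
    rw [map_div₀, h2]; field_simp
  have hu1 : τ / σ τ ≠ 1 := by
    intro h; rw [div_eq_one_iff_eq t2] at h; exact t1 h.symm
  refine ⟨τ / σ τ, hu, hu1, ?_, ?_⟩
  · intro h; rw [h, mul_one] at hu; exact hu1 hu
  · intro h; rw [← h] at hu
    exact hu1 (eq_of_sq_eq_sq_charTwo (by rw [one_pow, ← hu, pow_two]))

include h4 in
-- With `W = 0` the quadratics constrain only `r`, which is invariant under multiplying both phases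
-- by a `u` with `u * σ u = 1`.
lemma PhasePair.exists_scaled {c b e0 e1 : F} (hc : c * σ (σ c) = 1) (hc1 : c ≠ 1)
    (hb : b ≠ 0) (h : PhasePair σ c b e0 e1)
    (hw : phaseOuter σ c b (e0 * σ e1 + e1 * σ e0) = 0) :
    ∃ e0' e1', PhasePair σ c b e0' e1' ∧ e0' ≠ e0 ∧ b ≠ e1' ∧ b * σ (σ c) ≠ e0' := by
  obtain ⟨u, hu, u1, u2, u3⟩ := exists_unit_ne h4 hc hc1
  have e00 : e0 ≠ 0 := left_ne_zero_of_mul_eq_one h.unit0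
  have e10 : e1 ≠ 0 := left_ne_zero_of_mul_eq_one h.unit1
  have scaled : ∀ u, u * σ u = 1 → PhasePair σ c b (u * e0) (u * e1) := by
    intro u hu
    have h0 : u * e0 * σ (u * e0) = 1 := by
      rw [map_mul]; linear_combination u * σ u * h.unit0 + hu
    have h1 : u * e1 * σ (u * e1) = 1 := by
      rw [map_mul]; linear_combination u * σ u * h.unit1 + hu
    have hr : u * e0 * σ (u * e1) + u * e1 * σ (u * e0) = e0 * σ e1 + e1 * σ e0 := by
      simp only [map_mul]; linear_combination (e0 * σ e1 + e1 * σ e0) * hu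
    have q := (phasePair_iff_quadratics h4 hc h.unit0 h.unit1 rfl).1 h
    refine (phasePair_iff_quadratics h4 hc h0 h1 hr).2 ?_
    simpa only [hw, map_zero, zero_mul, add_zero, zero_add] using q
  have hu' : σ u * σ (σ u) = 1 := by simpa using congrArg σ hu
  have mm : ∀ u e : F, u * σ u = 1 → e * σ e = 1 → σ (σ (u * e)) = u * e := by
    intro u e hu he
    rw [map_mul, map_mul, map_map_of_mul_map hu, map_map_of_mul_map he]
  have ne : ∀ u, u ≠ 1 → u * e0 ≠ e0 := fun u hu h => hu (by simpa [e00] using h)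
  have key : ∀ u v : F, u * σ u = 1 → v * σ v = 1 → b = u * e1 → b * σ (σ c) = v * e0 → False := by
    intro u v hu hv h1 h2
    have k1 := mm u e1 hu h.unit1
    have k2 := mm v e0 hv h.unit0
    rw [← h1] at k1
    rw [← h2, map_mul, map_mul, h4, k1] at k2
    exact mul_map_map_ne hc hc1 (mul_left_cancel₀ hb k2).symm
  -- The values `b = e1'` and `b * σ (σ c) = e0'` would give the roots 0 and 1. If `u` hits one of
  -- them, `σ u` avoids both: by `key` the two kinds of coincidence cannot both occur.
  by_cases c1 : b = u * e1 ∨ b * σ (σ c) = u * e0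
  · refine ⟨_, _, scaled _ hu', ne _ u2, ?_, ?_⟩
    · rcases c1 with c1 | c1
      · intro c2; exact u3 (mul_right_cancel₀ e10 (c1 ▸ c2))
      · intro c2; exact key _ _ hu' hu c2 c1
    · rcases c1 with c1 | c1
      · intro c2; exact key _ _ hu hu' c1 c2
      · intro c2; exact u3 (mul_right_cancel₀ e00 (c1 ▸ c2))
  · push Not at c1
    exact ⟨_, _, scaled _ hu, ne _ u1, c1.1, c1.2⟩

include h4 in
lemma PhasePair.exists_conj {c b e0 e1 : F} (hc : c * σ (σ c) = 1)
    (h : PhasePair σ c b e0 e1) (hb1 : b ≠ e1) (hb0 : b * σ (σ c) ≠ e0)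
    (hw : phaseOuter σ c b (e0 * σ e1 + e1 * σ e0) ≠ 0)
    (hs : phaseMiddle σ c b 0 ≠ 0 ∨ phaseMiddle σ (σ (σ c)) (b * σ (σ c)) 0 ≠ 0) :
    ∃ e0' e1', PhasePair σ c b e0' e1' ∧ ¬ (e0' = e0 ∧ e1' = e1) ∧ b ≠ e1' ∧
      b * σ (σ c) ≠ e0' := by
  have two := CharTwo.two_eq_zero (R := F)
  obtain ⟨q1, q0⟩ := (phasePair_iff_quadratics h4 hc h.unit0 h.unit1 rfl).1 h
  have hrr := map_phaseCross h.unit0 h.unit1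
  generalize hrd : e0 * σ e1 + e1 * σ e0 = r at hw q1 q0 hrr
  have ww := map_map_phaseOuter h4 (c := c) (b := b) hrr
  generalize hwd : phaseOuter σ c b r = w at hw q1 q0 ww
  have hw' : σ w ≠ 0 := by simpa using hw
  have inv : ∀ e, e * σ e = 1 → w / σ w * σ e * σ (w / σ w * σ e) = 1 := by
    intro e he
    rw [map_mul, map_div₀, ww, map_map_of_mul_map he]
    field_simp; linear_combination he
  have fix : ∀ e, e * σ e = 1 → σ w * e + w * σ e = 0 → e = w / σ w * σ e := by
    intro e he h
    field_simp
    linear_combination h - w * σ e * two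
  have r' : w / σ w * σ e0 * σ (w / σ w * σ e1) + w / σ w * σ e1 * σ (w / σ w * σ e0) = r := by
    simp only [map_mul, map_div₀, ww, map_map_of_mul_map h.unit0, map_map_of_mul_map h.unit1]
    field_simp; linear_combination hrd
  -- The roots of the quadratic have product `w / σ w`, so `w / σ w * σ e` is the other root.
  refine ⟨w / σ w * σ e0, w / σ w * σ e1, (phasePair_iff_quadratics h4 hc (inv e0 h.unit0)
    (inv e1 h.unit1) r').2 ?_, ?_, ?_, ?_⟩
  · have a : ∀ e m, e * σ e = 1 → σ w * e + w * σ e + m = 0 →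
        σ w * (w / σ w * σ e) + w * σ (w / σ w * σ e) + m = 0 := by
      intro e m he h
      rw [map_mul, map_div₀, ww, map_map_of_mul_map he]
      field_simp; linear_combination h
    rw [hwd]
    exact ⟨a _ _ h.unit1 q1, a _ _ h.unit0 q0⟩
  · rintro ⟨k0, k1⟩
    have m : ∀ e m, w / σ w * σ e = e → σ w * e + w * σ e + m = 0 → m = 0 := by
      intro e m h h'
      field_simp at h
      linear_combination h' - h - σ w * e * two
    have m1 := m _ _ k1 q1
    have m0 := m _ _ k0 q0
    have e01 : e0 = e1 := by
      apply eq_of_sq_eq_sq_charTwo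
      field_simp at k0 k1
      apply mul_left_cancel₀ hw'
      linear_combination - e0 * k0 + e1 * k1 + w * h.unit0 - w * h.unit1
    have r0 : r = 0 := by rw [← hrd, e01]; linear_combination e1 * σ e1 * two
    rw [r0] at m1 m0
    rcases hs with hs | hs
    · exact hs m1
    · exact hs m0
  -- Were `b` the new root, it would be fixed by `σ ∘ σ`; the middle term would vanish, the root
  -- would be double, and `b = e1`.
  · intro k
    have hb := map_map_of_mul_map (inv e1 h.unit1)
    rw [← k] at hb
    rw [phaseMiddle_eq_zero_of_map_map h4 hb, add_zero] at q1
    exact hb1 (k.trans (fix _ h.unit1 q1).symm)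
  · intro k
    have hb := map_map_of_mul_map (inv e0 h.unit0)
    rw [← k] at hb
    rw [phaseMiddle_eq_zero_of_map_map h4 hb, add_zero] at q0
    exact hb0 (k.trans (fix _ h.unit0 q0).symm)

lemma isSolution_zero {c b : F} : IsSolution σ c b 0 ↔ b = 1 := by
  -- The convention `0 / 0 = 0` makes the term of `x = 0` vanish.
  have : IsSolution σ c b 0 ↔ 1 ^ 2 = b ^ 2 := by simp [IsSolution]
  rw [this]
  exact ⟨fun h => (eq_of_sq_eq_sq_charTwo h).symm, fun h => by rw [h]⟩

lemma isSolution_one {c b : F} : IsSolution σ c b 1 ↔ b = c := by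
  have : IsSolution σ c b 1 ↔ c ^ 2 = b ^ 2 := by
    simp [IsSolution, CharTwo.add_self_eq_zero]
  rw [this]
  exact ⟨fun h => (eq_of_sq_eq_sq_charTwo h).symm, fun h => by rw [h]⟩

include h4 in
lemma not_existsUnique_isSolution [Finite F] {c b : F} (hc : c * σ (σ c) = 1) (hc1 : c ≠ 1)
    (hs : phaseMiddle σ c b 0 ≠ 0 ∨ phaseMiddle σ (σ (σ c)) (b * σ (σ c)) 0 ≠ 0) :
    ¬ ∃! x, IsSolution σ c b x := by
  have two := CharTwo.two_eq_zero (R := F)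
  rintro ⟨x, hx, huniq⟩
  have m0 : ∀ b, phaseMiddle σ b 0 0 = 0 := by simp [phaseMiddle]
  have hb : b ≠ 0 := by
    rintro rfl
    simp [m0] at hs
  have x0 : x ≠ 0 := by
    rintro rfl
    rw [isSolution_zero] at hx
    subst hx
    rw [phaseMiddle_eq_zero_of_map_map h4 (by simp)] at hs
    simp only [phaseMiddle, one_mul, map_add, h4] at hs
    grind
  have x1 : x + 1 ≠ 0 := by
    intro h
    have : x = 1 := by linear_combination h - two
    subst this
    rw [isSolution_one] at hx
    subst hx
    rw [hc, phaseMiddle_eq_zero_of_map_map h4 (b := 1) (by simp)] at hs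
    simp only [phaseMiddle, map_add] at hs
    grind
  obtain ⟨e0, e1, hp, hD⟩ := exists_phasePair h4 hc hc1 x0 x1 hx
  have D0 := phase_denominator_ne_zero hc hc1 hp.unit0 hp.unit1
  have hb1 : b ≠ e1 := by
    rintro rfl
    rw [CharTwo.add_self_eq_zero] at hD
    exact mul_ne_zero x0 D0 hD
  have hb0 : b * σ (σ c) ≠ e0 := by
    intro h
    apply mul_ne_zero x1 D0
    linear_combination hD + (e1 + c * e0) * two + c * h - b * hc
  have : ∃ e0' e1', PhasePair σ c b e0' e1' ∧ ¬ (e0' = e0 ∧ e1' = e1) ∧ b ≠ e1' ∧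
      b * σ (σ c) ≠ e0' := by
    by_cases hw : phaseOuter σ c b (e0 * σ e1 + e1 * σ e0) = 0
    · obtain ⟨e0', e1', p, q, r⟩ := hp.exists_scaled h4 hc hc1 hb hw
      exact ⟨e0', e1', p, fun h => q h.1, r⟩
    · exact hp.exists_conj h4 hc hb1 hb0 hw hs
  obtain ⟨e0', e1', p, q, r1, r0⟩ := this
  obtain ⟨y, -, -, hy, p0, p1⟩ := p.exists_root h4 hc hc1 r1 r0
  obtain rfl := huniq y hy
  obtain ⟨k0, k1⟩ := (phasePair_iff h4 hc hc1 hp.unit0 hp.unit1 hD).1 hp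
  exact q ⟨p0.unique x0 k0, p1.unique x1 k1⟩

/-! ### Uniqueness when `b = s + w * c` -/

include h4 in
lemma map_map_trace (c : F) : σ (σ (c + σ (σ c))) = c + σ (σ c) := by
  rw [map_add, map_add, h4, add_comm]

lemma phaseOuter_of_span {c b r s w : F} (hc : c * σ (σ c) = 1) (hs : σ s = s) (hw : σ w = w)
    (hb : b = s + w * c) :
    phaseOuter σ c b r = (r + σ (c + σ (σ c))) *
      (s ^ 2 + w ^ 2 + s * w * (c + σ (σ c))) + (r + (c + σ (σ c))) := by
  subst hb
  simp only [phaseOuter, map_add, map_mul, hs, hw]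
  linear_combination (r + (σ c + σ (σ (σ c)))) * w ^ 2 * hc

include h4 in
lemma phaseMiddle_of_span {c b r s w : F} (hs : σ (σ s) = s) (hw : σ w = w)
    (hb : b = s + w * c) :
    phaseMiddle σ c b r = r * w * (c + σ (σ c) + σ (c + σ (σ c))) := by
  have two := CharTwo.two_eq_zero (R := F)
  subst hb
  simp only [phaseMiddle, map_add, map_mul, hs, hw]
  grind

include h4 in
lemma phaseMiddle_swap_of_span {c b r s w : F} (hc : c * σ (σ c) = 1) (hs : σ (σ s) = s)
    (hw : σ w = w) (hb : b = s + w * c) :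
    phaseMiddle σ (σ (σ c)) (b * σ (σ c)) r = r * (s * (c + σ (σ c)) + σ s * σ (c + σ (σ c))) +
      (s + σ s) * ((c + σ (σ c)) * σ (c + σ (σ c))) := by
  have two := CharTwo.two_eq_zero (R := F)
  have hc' : σ c * σ (σ (σ c)) = 1 := by simpa using congrArg σ hc
  subst hb
  simp only [phaseMiddle, map_add, map_mul, hs, hw, h4]
  grind

/-- Eliminates both phases, leaving a condition on `r`. `span_resultant` factors it; for `b ≠ 1, c`
every factor except `r ^ 2` is nonzero. -/
lemma phase_resultant {e0 e1 f0 f1 w w' a0 a1 r : F} (h0 : e0 * f0 = 1) (h1 : e1 * f1 = 1)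
    (q1 : w' * e1 + w * f1 + a1 = 0) (q0 : w' * e0 + w * f0 + a0 = 0)
    (hr : e0 * f1 + e1 * f0 = r) : r ^ 2 * (w * w') + a0 * a1 * r + a0 ^ 2 + a1 ^ 2 = 0 := by
  have two := CharTwo.two_eq_zero (R := F)
  grind

lemma span_resultant {r t t' s w : F} :
    r ^ 2 * (((r + t') * (s ^ 2 + w ^ 2 + s * w * t) + (r + t)) *
      ((r + t) * (s ^ 2 + w ^ 2 + s * w * t') + (r + t'))) +
      (r * s * (t + t')) * (r * w * (t + t')) * r + (r * s * (t + t')) ^ 2 +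
      (r * w * (t + t')) ^ 2 =
    r ^ 2 * ((r + t) * (r + t')) * ((s ^ 2 + w ^ 2 + s * w * t + 1) *
      (s ^ 2 + w ^ 2 + s * w * t' + 1)) := by
  have two := CharTwo.two_eq_zero (R := F)
  grind

lemma eq_of_span_norm_eq_one {t s w : F} (hs : σ s = s) (hw : σ w = w) (ht : σ t ≠ t)
    (h : s ^ 2 + w ^ 2 + s * w * t + 1 = 0) : s = 0 ∧ w = 1 ∨ s = 1 ∧ w = 0 := by
  have h' := congrArg σ h
  simp only [map_add, map_mul, map_pow, map_one, map_zero, hs, hw] at h'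
  have : s * w * (σ t - t) = 0 := by linear_combination h' - h
  have two := CharTwo.two_eq_zero (R := F)
  rcases mul_eq_zero.1 (mul_eq_zero.1 this |>.resolve_right (sub_ne_zero.2 ht)) with k | k
  · left; refine ⟨k, eq_of_sq_eq_sq_charTwo ?_⟩
    rw [k] at h; linear_combination h - two
  · right; refine ⟨eq_of_sq_eq_sq_charTwo ?_, k⟩
    rw [k] at h; linear_combination h - two

include h4 in
-- An Artin–Schreier argument. Vanishing would give `s + w = 1` and `s ^ 2 + s = 1 / t + 1 / σ t`
-- with `t = c + c⁻¹`. As `z = 1 / (c + 1)` solves `z ^ 2 + z = 1 / t`, the sum `s + z + σ z` would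
-- be 0 or 1; but `σ (σ z) = z + 1`, so `σ` moves it.
lemma phaseOuter_ne_zero_of_span {c b s w : F} (hc : c * σ (σ c) = 1) (hc1 : c ≠ 1)
    (hs : σ s = s) (hw : σ w = w) (hb : b = s + w * c) : phaseOuter σ c b 0 ≠ 0 := by
  have two := CharTwo.two_eq_zero (R := F)
  rw [phaseOuter_of_span hc hs hw hb]
  have t0 := trace_ne_zero h4 hc hc1
  have t1 := map_trace_ne h4 hc hc1
  have t2 := map_map_trace h4 c
  have c1 : c + 1 ≠ 0 := fun h => hc1 (by linear_combination h - two)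
  have hz : (1 / (c + 1)) ^ 2 + 1 / (c + 1) = 1 / (c + σ (σ c)) := by
    field_simp
    linear_combination hc + σ (σ c) * two
  have hz2 : σ (σ (1 / (c + 1))) = 1 / (c + 1) + 1 := by
    have : σ (σ c) + 1 ≠ 0 := by
      have : σ (σ (c + 1)) ≠ 0 := by simpa only [ne_eq, map_eq_zero] using c1
      simpa using this
    simp only [map_div₀, map_add, map_one]
    field_simp
    linear_combination - hc - (1 + σ (σ c)) * two
  generalize 1 / (c + 1) = z at hz hz2
  generalize c + σ (σ c) = t at *
  intro h
  have h' := congrArg σ h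
  simp only [map_add, map_mul, map_pow, map_zero, hs, hw, t2] at h'
  have g : (s + w) ^ 2 = 1 ^ 2 := by
    have : (σ t - t) * ((s + w) ^ 2 - 1 ^ 2) = 0 := by grind
    exact sub_eq_zero.1 ((mul_eq_zero.1 this).resolve_left (sub_ne_zero.2 t1))
  have g := eq_of_sq_eq_sq_charTwo g
  have t0' : σ t ≠ 0 := by simpa using t0
  have sz : s ^ 2 + s = 1 / t + 1 / σ t := by
    field_simp
    grind
  have hz' := congrArg σ hz
  simp only [map_add, map_pow, map_div₀, map_one] at hz'
  have y : (s + z + σ z) * (s + z + σ z + 1) = 0 := by grind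
  have y1 : σ (s + z + σ z) = s + z + σ z := by
    rcases mul_eq_zero.1 y with y | y
    · rw [y, map_zero]
    · have : s + z + σ z = 1 := by linear_combination y - two
      rw [this, map_one]
  simp only [map_add, hs, hz2] at y1
  exact one_ne_zero (α := F) (by linear_combination y1)

include h4 in
lemma phasePair_eq_of_span {c b s w e0 e1 : F} (hc : c * σ (σ c) = 1) (hc1 : c ≠ 1)
    (hs : σ s = s) (hw : σ w = w) (hb : b = s + w * c) (hb1 : b ≠ 1) (hbc : b ≠ c)
    (h : PhasePair σ c b e0 e1) :
    e0 = e1 ∧ σ (phaseOuter σ c b 0) * e1 + phaseOuter σ c b 0 * σ e1 = 0 := by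
  have two := CharTwo.two_eq_zero (R := F)
  obtain ⟨q1, q0⟩ := (phasePair_iff_quadratics h4 hc h.unit0 h.unit1 rfl).1 h
  have hrr := map_phaseCross h.unit0 h.unit1
  have hss : σ (σ s) = s := by rw [hs, hs]
  have k := phase_resultant h.unit0 h.unit1 q1 q0 rfl
  generalize hr : e0 * σ e1 + e1 * σ e0 = r at k q1 q0 hrr
  have t1 := map_trace_ne h4 hc hc1
  have t2 := map_map_trace h4 c
  have hA0 : phaseMiddle σ (σ (σ c)) (b * σ (σ c)) r =
      r * s * (c + σ (σ c) + σ (c + σ (σ c))) := by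
    rw [phaseMiddle_swap_of_span h4 hc hss hw hb, hs]
    linear_combination s * ((c + σ (σ c)) * σ (c + σ (σ c))) * two
  rw [hA0, phaseMiddle_of_span h4 hss hw hb] at k
  rw [phaseOuter_of_span hc hs hw hb] at k
  have hr0 : r = 0 := by
    generalize c + σ (σ c) = t at *
    simp only [map_add σ, map_mul, map_pow, hs, hw, hrr, t2] at k
    rw [span_resultant] at k
    rcases mul_eq_zero.1 k with k | k
    · rcases mul_eq_zero.1 k with k | k
      · simpa using k
      · exfalso
        rcases mul_eq_zero.1 k with k | k
        · apply t1
          have : r = t := by linear_combination k - t * two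
          rwa [this] at hrr
        · apply t1
          have : r = σ t := by linear_combination k - σ t * two
          rw [this, t2] at hrr
          exact hrr.symm
    · exfalso
      have : s = 0 ∧ w = 1 ∨ s = 1 ∧ w = 0 := by
        rcases mul_eq_zero.1 k with k | k
        · exact eq_of_span_norm_eq_one hs hw t1 k
        · refine eq_of_span_norm_eq_one hs hw ?_ k
          rw [t2]; exact t1.symm
      rcases this with ⟨rfl, rfl⟩ | ⟨rfl, rfl⟩
      · exact hbc (by simp [hb])
      · exact hb1 (by simp [hb])
  subst hr0
  constructor
  · apply eq_of_sq_eq_sq_charTwo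
    linear_combination e0 * e1 * hr - e0 ^ 2 * h.unit1 - e1 ^ 2 * h.unit0 - e1 ^ 2 * two
  · rw [phaseMiddle_of_span h4 hss hw hb] at q1
    linear_combination q1

include h4 in
lemma existsUnique_isSolution_of_span [Finite F] {c b s w : F} (hc : c * σ (σ c) = 1)
    (hc1 : c ≠ 1) (hs : σ s = s) (hw : σ w = w) (hb : b = s + w * c) :
    ∃! x, IsSolution σ c b x := by
  have two := CharTwo.two_eq_zero (R := F)
  have hss : σ (σ s) = s := by rw [hs, hs]
  have t1 := map_trace_ne h4 hc hc1
  have t2 := map_map_trace h4 c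
  have cases_of : ∀ x, IsSolution σ c b x → b ≠ 1 → b ≠ c → x ≠ 0 ∧ x + 1 ≠ 0 := by
    refine fun x hx h1 h2 => ⟨?_, ?_⟩
    · rintro rfl; exact h1 (isSolution_zero.1 hx)
    · intro h
      have : x = 1 := by linear_combination h - two
      subst this; exact h2 (isSolution_one.1 hx)
  -- For `b = 1` or `b = c` the outer coefficient is `σ t + t`, nonzero and fixed by `σ`, which
  -- forces `e = σ e`.
  have one_of : ∀ e : F, e * σ e = 1 →
      σ (σ (c + σ (σ c)) + (c + σ (σ c))) * e + (σ (c + σ (σ c)) + (c + σ (σ c))) * σ e = 0 →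
      e = 1 := by
    intro e he h
    rw [map_add, t2] at h
    generalize c + σ (σ c) = t at *
    have : (σ t - t) * (e - σ e) = 0 := by grind
    have := (mul_eq_zero.1 this).resolve_left (sub_ne_zero.2 t1)
    apply eq_of_sq_eq_sq_charTwo
    linear_combination he + e * this
  by_cases hb1 : b = 1
  · refine ⟨0, isSolution_zero.2 hb1, fun x hx => ?_⟩
    by_contra x0
    have x1 : x + 1 ≠ 0 := by
      intro h
      have : x = 1 := by linear_combination h - two
      subst this; exact hc1 ((isSolution_one.1 hx).symm.trans hb1)
    obtain ⟨e0, e1, hp, hD⟩ := exists_phasePair h4 hc hc1 x0 x1 hx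
    have q := ((phasePair_iff_quadratics h4 hc hp.unit0 hp.unit1 rfl).1 hp).1
    have D0 := phase_denominator_ne_zero hc hc1 hp.unit0 hp.unit1
    rw [phaseMiddle_eq_zero_of_map_map h4 (by simp [hb1]), add_zero] at q
    have : phaseOuter σ c b (e0 * σ e1 + e1 * σ e0) = σ (c + σ (σ c)) + (c + σ (σ c)) := by
      simp only [phaseOuter, hb1, map_one]
      linear_combination (e0 * σ e1 + e1 * σ e0) * two
    rw [this] at q
    have e11 := one_of e1 hp.unit1 q
    rw [e11, hb1, CharTwo.add_self_eq_zero, ← e11] at hD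
    exact mul_ne_zero x0 D0 hD
  by_cases hbc : b = c
  · refine ⟨1, isSolution_one.2 hbc, fun x hx => ?_⟩
    have x0 : x ≠ 0 := by
      rintro rfl
      exact hb1 (isSolution_zero.1 hx)
    by_contra x1
    replace x1 : x + 1 ≠ 0 := fun h => x1 (by linear_combination h - two)
    obtain ⟨e0, e1, hp, hD⟩ := exists_phasePair h4 hc hc1 x0 x1 hx
    have q := ((phasePair_iff_quadratics h4 hc hp.unit0 hp.unit1 rfl).1 hp).2
    have D0 := phase_denominator_ne_zero hc hc1 hp.unit0 hp.unit1
    rw [hbc, hc, phaseMiddle_eq_zero_of_map_map h4 (by simp), add_zero] at q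
    have : phaseOuter σ c c (e0 * σ e1 + e1 * σ e0) = σ (c + σ (σ c)) + (c + σ (σ c)) := by
      simp only [phaseOuter, hc]
      linear_combination (e0 * σ e1 + e1 * σ e0) * two
    rw [this] at q
    have e01 := one_of e0 hp.unit0 q
    apply mul_ne_zero x1 D0
    rw [hbc] at hD
    linear_combination hD + c * e01 + (c + e1) * two
  set W := phaseOuter σ c b 0 with hW
  have W0 : W ≠ 0 := phaseOuter_ne_zero_of_span h4 hc hc1 hs hw hb
  have W1 : σ W ≠ 0 := by simpa using W0
  have W2 : σ (σ W) = W := map_map_phaseOuter h4 (map_zero σ)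
  cases nonempty_fintype F
  obtain ⟨e, he⟩ := FiniteField.isSquare_of_char_two (ringChar.eq F 2 ▸ rfl) (W / σ W)
  rw [← pow_two] at he
  have heu : e * σ e = 1 := by
    apply eq_of_sq_eq_sq_charTwo
    rw [mul_pow, ← map_pow, ← he, map_div₀, W2]
    field_simp
  have quad : σ W * e + W * σ e = 0 := by
    rw [div_eq_iff W1] at he
    linear_combination he * σ e + e * σ W * heu + e * σ W * two
  have hp : PhasePair σ c b e e := by
    refine (phasePair_iff_quadratics h4 hc heu heu (r := 0) ?_).2 ⟨?_, ?_⟩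
    · exact CharTwo.add_self_eq_zero _
    · rw [phaseMiddle_of_span h4 hss hw hb]; linear_combination quad
    · rw [phaseMiddle_swap_of_span h4 hc hss hw hb, hs, CharTwo.add_self_eq_zero s]
      linear_combination quad
  have hK := map_map_of_mul_map heu
  have cK := mul_map_map_ne hc hc1
  obtain ⟨x, x0, x1, hx, -, -⟩ := hp.exists_root h4 hc hc1 (by
    intro h
    have h' := hK
    rw [← h, hb] at h'
    simp only [map_add, map_mul, hs, hw] at h'
    have : w * (σ (σ c) - c) = 0 := by linear_combination h'
    have w0 := (mul_eq_zero.1 this).resolve_right (sub_ne_zero.2 cK)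
    rw [w0, zero_mul, add_zero] at hb
    apply hb1
    apply eq_of_sq_eq_sq_charTwo
    rw [← h, hb, hs] at heu
    rw [hb]; linear_combination heu) (by
    intro h
    have h' := hK
    rw [← h, hb] at h'
    simp only [map_add, map_mul, hs, hw, h4] at h'
    have : s * (σ (σ c) - c) = 0 := by
      linear_combination - h'
    have s0 := (mul_eq_zero.1 this).resolve_right (sub_ne_zero.2 cK)
    rw [s0, zero_add] at hb
    have we : w = e := by rw [← h, hb]; linear_combination - w * hc
    have : w = 1 := by
      apply eq_of_sq_eq_sq_charTwo
      rw [← we, hw] at heu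
      linear_combination heu
    exact hbc (by rw [hb, this, one_mul]))
  have form : ∀ y, IsSolution σ c b y → y * (e + c * e) = b + e := by
    intro y hy
    obtain ⟨y0, y1⟩ := cases_of y hy hb1 hbc
    obtain ⟨e0, e1, hp', hD⟩ := exists_phasePair h4 hc hc1 y0 y1 hy
    obtain ⟨rfl, q⟩ := phasePair_eq_of_span h4 hc hc1 hs hw hb hb1 hbc hp'
    have : e0 = e := by
      apply eq_of_sq_eq_sq_charTwo
      rw [← he, eq_div_iff W1]
      rw [← hW] at q
      linear_combination e0 * q - W * hp'.unit0 - W * two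
    rwa [this] at hD
  refine ⟨x, hx, fun y hy => ?_⟩
  exact mul_right_cancel₀ (phase_denominator_ne_zero hc hc1 heu heu)
    ((form y hy).trans (form x hx).symm)

/-! ### The trace conditions -/

lemma trace_square_identity {c c1 c2 c3 s s1 w : F} (hc : c * c2 = 1) (hc' : c1 * c3 = 1) :
    c * c1 * (s + w * c2 + (s1 + w * c3)) ^ 2 + c1 * c2 * (s1 + w * c3 + (s + w * c)) ^ 2 +
      c2 * c3 * (s + w * c + (s1 + w * c1)) ^ 2 + c3 * c * (s1 + w * c1 + (s + w * c2)) ^ 2 =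
    (s + s1) ^ 2 * ((c + c2) * (c1 + c3)) := by
  have two := CharTwo.two_eq_zero (R := F)
  grind

include h4 in
lemma trace_conditions {c b v : F} (hc : c * σ (σ c) = 1) (hc1 : c ≠ 1)
    (hv : v = σ b + σ (σ b)) {tr : F → F}
    (htr : ∀ y, tr y = y + σ y + σ (σ y) + σ (σ (σ y))) :
    (tr (c * σ c * σ v ^ 2) = 0 ∧ tr (c * (v + σ v)) = 0 →
      ∃ s w, σ s = s ∧ σ w = w ∧ b = s + w * c) ∧
    (phaseMiddle σ c b 0 = 0 ∧ phaseMiddle σ (σ (σ c)) (b * σ (σ c)) 0 = 0 →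
      tr (c * σ c * σ v ^ 2) = 0 ∧ tr (c * (v + σ v)) = 0) := by
  have two := CharTwo.two_eq_zero (R := F)
  have t0 := trace_ne_zero h4 hc hc1
  have t0' : σ (c + σ (σ c)) ≠ 0 := by simpa only [ne_eq, map_eq_zero] using t0
  have t2 := map_map_trace h4 c
  have T1 : tr (c * (v + σ v)) = phaseMiddle σ c b 0 := by
    rw [htr, hv]
    simp only [phaseMiddle, map_add, map_mul, h4]
    grind
  -- Coordinates of `b` in the basis `1, c` over the fixed field of `σ ∘ σ`, once `w` is known to be
  -- fixed. The second trace controls `σ w = w`, then the first controls `σ s = s`.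
  obtain ⟨w, hw⟩ : ∃ w, w = (b + σ (σ b)) / (c + σ (σ c)) := ⟨_, rfl⟩
  obtain ⟨s, hs⟩ : ∃ s, s = b + w * c := ⟨_, rfl⟩
  have hb : b = s + w * c := by rw [hs]; linear_combination - w * c * two
  have hw' := hw
  rw [eq_div_iff t0] at hw'
  have wfix : phaseMiddle σ c b 0 = 0 → σ w = w := by
    intro h
    rw [hw, map_div₀, div_eq_div_iff t0' t0]
    simp only [phaseMiddle, zero_add] at h
    linear_combination h - σ (c + σ (σ c)) * (b + σ (σ b)) * two
  have sK : σ w = w → σ (σ s) = s := by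
    intro h
    rw [hs]
    simp only [map_add, map_mul, h]
    linear_combination hw' + (σ (σ b) - w * c) * two
  have T2 : σ w = w → tr (c * σ c * σ v ^ 2) =
      (s + σ s) ^ 2 * ((c + σ (σ c)) * σ (c + σ (σ c))) := by
    intro h
    have k := sK h
    rw [htr, hv, hb]
    simp only [map_add, map_mul, map_pow, h4, h, k]
    exact trace_square_identity hc (by simpa using congrArg σ hc)
  have M2 : σ w = w → phaseMiddle σ (σ (σ c)) (b * σ (σ c)) 0 =
      (s + σ s) * ((c + σ (σ c)) * σ (c + σ (σ c))) := by
    intro h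
    rw [phaseMiddle_swap_of_span h4 hc (sK h) h hb]; ring
  constructor
  · rintro ⟨h2, h1⟩
    have k := wfix (T1 ▸ h1)
    rw [T2 k] at h2
    have : s + σ s = 0 := by
      simpa using (mul_eq_zero.1 h2).resolve_right (mul_ne_zero t0 t0')
    exact ⟨s, w, by linear_combination this - s * two, k, hb⟩
  · rintro ⟨h1, h2⟩
    have k := wfix h1
    rw [M2 k] at h2
    have : s + σ s = 0 := (mul_eq_zero.1 h2).resolve_right (mul_ne_zero t0 t0')
    rw [T2 k, T1, this]
    exact ⟨by ring, h1⟩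

end CharTwo

/-! ### Translation to the field with `q ^ 4` elements -/

lemma pow_exponent_eq {F : Type*} [Field F] {q : ℕ} (hq : 1 ≤ q) (x : F) :
    x ^ ((q - 1) * (q ^ 2 + 1) + 2) = x ^ 2 * ((x * (x ^ q) ^ q) ^ q / (x * (x ^ q) ^ q)) := by
  obtain ⟨k, rfl⟩ := Nat.exists_eq_add_of_le' hq
  by_cases hx : x = 0
  · simp [hx]
  have n0 : x * (x ^ (k + 1)) ^ (k + 1) ≠ 0 := by simp [hx]
  rw [pow_succ (x * _), mul_div_assoc, div_self n0, mul_one, Nat.add_sub_cancel, pow_add, mul_comm]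
  congr 1
  rw [← pow_mul, ← pow_succ', ← pow_mul, mul_comm, ← pow_two]

theorem proposition7 {F : Type*} [Field F] [Fintype F] (n q : ℕ) (hn : 1 ≤ n) (hq : q = 2 ^ n)
    (hF : Fintype.card F = q ^ 4) (c : F) (hc : c ^ (q ^ 2 + 1) = 1) (hc1 : c ≠ 1)
    (b v : F) (hv : v = b ^ q + b ^ (q ^ 2)) :
    (∃! x : F, (x + 1) ^ ((q - 1) * (q ^ 2 + 1) + 2)
        + c ^ 2 * x ^ ((q - 1) * (q ^ 2 + 1) + 2) = b ^ 2) ↔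
      (relTrace n (4 * n) (c ^ (q + 1) * v ^ (2 * q)) = 0 ∧
        relTrace n (4 * n) (c * (v + v ^ q)) = 0) := by
  have q1 : 1 ≤ q := hq ▸ Nat.one_le_two_pow
  have : CharP F 2 := by
    have : Fact (Nat.Prime 2) := ⟨Nat.prime_two⟩
    refine charP_of_card_eq_prime_pow (f := n * 4) ?_
    rw [hF, hq, pow_mul]
  let σ : F →+* F := iterateFrobenius F 2 n
  have hσ : ∀ x, σ x = x ^ q := fun x => by rw [hq]; exact iterateFrobenius_def 2 n x
  have h4 : ∀ x, σ (σ (σ (σ x))) = x := by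
    intro x
    simp only [hσ, ← pow_mul]
    have := FiniteField.pow_card x
    rw [hF] at this
    convert this using 2
    ring
  have hc' : c * σ (σ c) = 1 := by
    rw [← hc, hσ, hσ, ← pow_mul, pow_two, ← pow_succ']
  have hroot : ∀ x, (x + 1) ^ ((q - 1) * (q ^ 2 + 1) + 2) +
      c ^ 2 * x ^ ((q - 1) * (q ^ 2 + 1) + 2) = b ^ 2 ↔ IsSolution σ c b x := by
    intro x
    rw [IsSolution, pow_exponent_eq q1, pow_exponent_eq q1 x]
    simp only [hσ]
  have htr : ∀ y : F, relTrace n (4 * n) y = y + σ y + σ (σ y) + σ (σ (σ y)) := by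
    intro y
    have : 4 * n / n = 4 := Nat.mul_div_cancel _ hn
    simp only [relTrace, this, Finset.sum_range_succ, Finset.sum_range_zero, hσ, ← pow_mul, hq]
    ring_nf
  have hv' : v = σ b + σ (σ b) := by rw [hv, hσ, hσ, ← pow_mul, ← pow_two]
  have e2 : c ^ (q + 1) * v ^ (2 * q) = c * σ c * σ v ^ 2 := by
    rw [hσ, hσ]; ring
  obtain ⟨k1, k2⟩ := trace_conditions h4 hc' hc1 hv' htr
  rw [e2, show v ^ q = σ v from (hσ v).symm, existsUnique_congr hroot]
  constructor
  · intro h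
    by_contra hcon
    refine not_existsUnique_isSolution h4 hc' hc1 ?_ h
    by_contra! hm
    exact hcon (k2 hm)
  · intro h
    obtain ⟨s, w, hs, hw, hb⟩ := k1 h
    exact existsUnique_isSolution_of_span h4 hc' hc1 hs hw hb
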